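/- Let $n\ge 2$, let $\Omega\subset\mathbb{R}^n$ be a domain, and let $E\subset\Omega$ be closed in $\Omega$ with $\mathcal{H}^{n-1}(E)=0$, where $\mathcal{H}^{n-1}$ denotes the $(n-1)$-dimensional Hausdorff measure. Let $u:\Omega\setminus E\to\mathbb{R}$ be harmonic and such that (i) $u\in L^1_{\mathrm{loc}}(\Omega)$, and (ii) for each $1\le j\le n$, $\dfrac{\partial^2 u}{\partial x_j^2}\in L^1_{\mathrm{loc}}(\Omega)$. (Since $E$ has Lebesgue measure zero, $u$ and $\partial^2u/\partial x_j^2$, which are defined on $\Omega\setminus E$, are defined almost everywhere in $\Omega$; the second partial derivatives are the classical pointwise ones on $\Omega\setminus E$.) Then $u$ has a unique harmonic extension to $\Omega$: there is a harmonic function $v:\Omega\to\mathbb{R}$ with $v=u$ on $\Omega\setminus E$, and every harmonic function on $\Omega$ that equals $u$ on $\Omega\setminus E$ equals $v$ on $\Omega$. -/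

import Mathlib

open MeasureTheory

/-- The pure second partial derivative `∂²u/∂x_j²` of `u : ℝⁿ → ℝ` at the point `x`, that is, the
directional derivative in the direction of the `j`-th standard unit vector, taken twice. -/
noncomputable def secondPartial {n : ℕ} (j : Fin n) (u : EuclideanSpace ℝ (Fin n) → ℝ)
    (x : EuclideanSpace ℝ (Fin n)) : ℝ :=
  lineDeriv ℝ (fun y => lineDeriv ℝ u y (EuclideanSpace.single j 1)) x (EuclideanSpace.single j 1)

/-! Coordinate projections are 1-Lipschitz, so `E` projects to null sets and almost every line
parallel to an axis misses `E`. On such lines `u` is C² and may be integrated by parts twice against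
a test function; Fubini, justified by local integrability of `u` and its pure second partials, then
makes `u` weakly harmonic on all of `Ω` (`integral_mul_sum_secondPartial_eq_zero`).

Weyl's lemma follows through radial means. The `l`-derivative of the kernel `radialKernel G l (x -
y)` is a multiple of the Laplacian in `y` of a test function (`hasDerivAt_radialKernel`), so the
mean of `u` does not depend on `l`; letting `l → ∞` identifies it with `u x`. Locally `u` is thus a
C² convolution off `E`. Since `E` has dense complement, these local extensions glue, are harmonic,
and are unique. -/

/-! ### Integration by parts on a line -/

theorem integral_mul_deriv_deriv_sub_eq_zero {f p : ℝ → ℝ} (hp : ContDiff ℝ 2 p)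
    (hpc : HasCompactSupport p) (hf : ∀ t ∈ tsupport p, ContDiffAt ℝ 2 f t) :
    ∫ t, (f t * deriv (deriv p) t - deriv (deriv f) t * p t) = 0 := by
  -- The integrand is `deriv g`. Off `tsupport p`, where `f` may be irregular, `g` is locally zero.
  set g : ℝ → ℝ := fun t => f t * deriv p t - deriv f t * p t with hg
  have hp' : ContDiff ℝ 1 (deriv p) := hp.deriv' (n := 1)
  have hsupp : Function.support g ⊆ tsupport p := by
    intro t ht
    by_contra h
    have h1 : p t = 0 := image_eq_zero_of_notMem_tsupport h
    have h2 : deriv p t = 0 := by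
      by_contra h3
      exact h (support_deriv_subset h3)
    exact ht (by simp [hg, h1, h2])
  have hgc : HasCompactSupport g := hpc.mono' hsupp
  have hder : ∀ t ∈ tsupport p, ContDiffAt ℝ 1 (deriv f) t := fun t ht =>
    ((hf t ht).fderiv_right (m := 1) (by norm_num)).clm_apply contDiffAt_const
  have hg1 : ContDiff ℝ 1 g := by
    rw [contDiff_iff_contDiffAt]
    intro t
    by_cases ht : t ∈ tsupport p
    · exact (((hf t ht).of_le (by norm_num)).mul hp'.contDiffAt).sub
        ((hder t ht).mul (hp.of_le (by norm_num)).contDiffAt)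
    · have : g =ᶠ[nhds t] fun _ => 0 := by
        filter_upwards [(isClosed_tsupport p).isOpen_compl.mem_nhds ht] with s hs
        by_contra h
        exact hs (hsupp h)
      exact contDiffAt_const.congr_of_eventuallyEq this
  have key : ∀ t, deriv g t = f t * deriv (deriv p) t - deriv (deriv f) t * p t := by
    intro t
    by_cases ht : t ∈ tsupport p
    · have h1 := ((hf t ht).differentiableAt (by norm_num)).hasDerivAt
      have h2 := ((hder t ht).differentiableAt (by norm_num)).hasDerivAt
      have h3 := ((hp.differentiable (by norm_num)) t).hasDerivAt
      have h4 := ((hp'.differentiable (by norm_num)) t).hasDerivAt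
      have := ((h1.mul h4).sub (h2.mul h3)).deriv
      have h5 : g = f * deriv p - deriv f * p := rfl
      rw [h5, this]
      ring
    · have h0 : p =ᶠ[nhds t] fun _ => 0 := by
        filter_upwards [(isClosed_tsupport p).isOpen_compl.mem_nhds ht] with s hs
        exact image_eq_zero_of_notMem_tsupport hs
      have h1 : g =ᶠ[nhds t] fun _ => 0 := by
        filter_upwards [(isClosed_tsupport p).isOpen_compl.mem_nhds ht] with s hs
        by_contra h
        exact hs (hsupp h)
      have h2 : deriv (deriv p) t = 0 := by
        rw [h0.deriv.deriv_eq]; simp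
      rw [h1.deriv_eq, h2, h0.eq_of_nhds]
      simp
  simp_rw [← key]
  exact integral_eq_zero_of_hasDerivAt_of_integrable
    (fun t => ((hg1.differentiable (by norm_num)) t).hasDerivAt)
    ((hg1.continuous_deriv (by norm_num)).integrable_of_hasCompactSupport hgc.deriv)
    (hg1.continuous.integrable_of_hasCompactSupport hgc)

/-! ### Pure second partials and the Laplacian -/

theorem lineDeriv_add_smul {F : Type*} [NormedAddCommGroup F] [NormedSpace ℝ F] (u : F → ℝ)
    (x e : F) (s : ℝ) :
    lineDeriv ℝ u (x + s • e) e = deriv (fun t : ℝ => u (x + t • e)) s := by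
  have := deriv_comp_const_add (fun t : ℝ => u (x + t • e)) s 0
  rw [add_zero] at this
  rw [← this, lineDeriv]
  simp only [add_smul, add_assoc]

theorem secondPartial_add_smul {n : ℕ} (j : Fin n) (u : EuclideanSpace ℝ (Fin n) → ℝ)
    (x : EuclideanSpace ℝ (Fin n)) (s : ℝ) :
    secondPartial j u (x + s • EuclideanSpace.single j 1) =
      deriv (deriv fun t : ℝ => u (x + t • EuclideanSpace.single j 1)) s := by
  rw [secondPartial, lineDeriv_add_smul]
  congr 1
  ext t
  exact lineDeriv_add_smul _ _ _ _

theorem secondPartial_eq_iteratedFDeriv {n : ℕ} (j : Fin n) {u : EuclideanSpace ℝ (Fin n) → ℝ}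
    {x : EuclideanSpace ℝ (Fin n)} (hu : ContDiffAt ℝ 2 u x) :
    secondPartial j u x = iteratedFDeriv ℝ 2 u x
      ![EuclideanSpace.single j 1, EuclideanSpace.single j 1] := by
  have h1 : (fun y => lineDeriv ℝ u y (EuclideanSpace.single j 1)) =ᶠ[nhds x]
      fun y => fderiv ℝ u y (EuclideanSpace.single j 1) := by
    filter_upwards [hu.eventually (by simp)] with y hy
    exact (hy.differentiableAt (by norm_num)).lineDeriv_eq_fderiv
  have h2 : DifferentiableAt ℝ (fderiv ℝ u) x :=
    (hu.fderiv_right (m := 1) (by norm_num)).differentiableAt (by norm_num)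
  rw [secondPartial, h1.lineDeriv_eq,
    (h2.clm_apply (differentiableAt_const _)).lineDeriv_eq_fderiv, iteratedFDeriv_two_apply,
    fderiv_clm_apply h2 (differentiableAt_const _)]
  simp

theorem sum_secondPartial_eq_laplacian {n : ℕ} {u : EuclideanSpace ℝ (Fin n) → ℝ}
    {x : EuclideanSpace ℝ (Fin n)} (hu : ContDiffAt ℝ 2 u x) :
    ∑ j, secondPartial j u x = Laplacian.laplacian u x := by
  rw [InnerProductSpace.laplacian_eq_iteratedFDeriv_orthonormalBasis u
    (EuclideanSpace.basisFun (Fin n) ℝ)]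
  simp [secondPartial_eq_iteratedFDeriv _ hu]

theorem continuous_secondPartial {n : ℕ} (j : Fin n) {u : EuclideanSpace ℝ (Fin n) → ℝ}
    (hu : ContDiff ℝ 2 u) : Continuous (secondPartial j u) := by
  have : secondPartial j u = fun x => iteratedFDeriv ℝ 2 u x
      ![EuclideanSpace.single j 1, EuclideanSpace.single j 1] :=
    funext fun x => secondPartial_eq_iteratedFDeriv j hu.contDiffAt
  rw [this]
  have h := hu.continuous_iteratedFDeriv (m := 2) le_rfl
  fun_prop

theorem support_secondPartial_subset {n : ℕ} (j : Fin n) (u : EuclideanSpace ℝ (Fin n) → ℝ) :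
    Function.support (secondPartial j u) ⊆ tsupport u := by
  intro x hx
  by_contra h
  have h0 : u =ᶠ[nhds x] fun _ => 0 := by
    filter_upwards [(isClosed_tsupport u).isOpen_compl.mem_nhds h] with s hs
    exact image_eq_zero_of_notMem_tsupport hs
  apply hx
  rw [secondPartial_eq_iteratedFDeriv j (contDiffAt_const.congr_of_eventuallyEq h0),
    (h0.iteratedFDeriv ℝ 2).eq_of_nhds]
  simp

/-! ### Lines parallel to an axis and null sets -/

/-- The point of `ℝᵐ⁺¹` whose `j`-th coordinate is `p.1` and whose other coordinates are `p.2`. -/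
def insertCoord {m : ℕ} (j : Fin (m + 1)) (p : ℝ × (Fin m → ℝ)) : EuclideanSpace ℝ (Fin (m + 1)) :=
  WithLp.toLp 2 (j.insertNth p.1 p.2)

theorem insertCoord_eq_add_smul {m : ℕ} (j : Fin (m + 1)) (t : ℝ) (z : Fin m → ℝ) :
    insertCoord j (t, z) = insertCoord j (0, z) + t • EuclideanSpace.single j 1 := by
  ext i
  refine j.succAboveCases ?_ (fun k => ?_) i <;> simp [insertCoord]

theorem measurePreserving_insertCoord {m : ℕ} (j : Fin (m + 1)) :
    MeasurePreserving (insertCoord j) :=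
  (PiLp.volume_preserving_toLp _).comp
    (volume_preserving_piFinSuccAbove (fun _ : Fin (m + 1) => ℝ) j).symm

theorem measurableEmbedding_insertCoord {m : ℕ} (j : Fin (m + 1)) :
    MeasurableEmbedding (insertCoord j) :=
  (MeasurableEquiv.toLp 2 (Fin (m + 1) → ℝ)).measurableEmbedding.comp
    (MeasurableEquiv.piFinSuccAbove (fun _ : Fin (m + 1) => ℝ) j).symm.measurableEmbedding

/-- Forgetting coordinate `j` does not increase `μH[m]`, which on `Fin m → ℝ` is Lebesgue measure.
-/
theorem ae_forall_insertCoord_notMem {m : ℕ} (j : Fin (m + 1))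
    {E : Set (EuclideanSpace ℝ (Fin (m + 1)))} (hE : μH[(m : ℝ)] E = 0) :
    ∀ᵐ z : Fin m → ℝ, ∀ t : ℝ, insertCoord j (t, z) ∉ E := by
  set π : EuclideanSpace ℝ (Fin (m + 1)) → (Fin m → ℝ) := fun x k => x (j.succAbove k) with hπ
  have hlip : LipschitzWith 1 π := by
    refine LipschitzWith.of_dist_le_mul fun x y => ?_
    rw [NNReal.coe_one, one_mul, dist_pi_le_iff dist_nonneg]
    intro k
    rw [dist_eq_norm, dist_eq_norm]
    exact PiLp.norm_apply_le (x - y) _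
  have h1 : volume (π '' E) = 0 := by
    have h2 := hlip.hausdorffMeasure_image_le (d := (m : ℝ)) (by positivity) E
    rw [hE, mul_zero, nonpos_iff_eq_zero] at h2
    rw [← hausdorffMeasure_pi_real]
    simpa using h2
  filter_upwards [measure_eq_zero_iff_ae_notMem.1 h1] with z hz t ht
  exact hz ⟨_, ht, by ext k; simp [hπ, insertCoord]⟩

theorem volume_eq_zero_of_hausdorffMeasure_eq_zero {m : ℕ}
    {E : Set (EuclideanSpace ℝ (Fin (m + 1)))} (hE : μH[(m : ℝ)] E = 0) : volume E = 0 := by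
  rw [measure_eq_zero_iff_ae_notMem]
  rw [← (measurePreserving_insertCoord 0).map_eq, (measurableEmbedding_insertCoord 0).ae_map_iff]
  exact Measure.quasiMeasurePreserving_snd.ae (ae_forall_insertCoord_notMem 0 hE) |>.mono
    fun p hp => hp p.1

theorem MeasureTheory.LocallyIntegrableOn.integrable_mul_of_support_subset {n : ℕ}
    {u φ : EuclideanSpace ℝ (Fin n) → ℝ} {Ω K : Set (EuclideanSpace ℝ (Fin n))}
    (hu : LocallyIntegrableOn u Ω) (hK : IsCompact K) (hKΩ : K ⊆ Ω)
    (hφ : Continuous φ) (hs : Function.support φ ⊆ K) : Integrable (fun x => u x * φ x) := by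
  have h2 : IntegrableOn (fun x => u x * φ x) K :=
    (hu.integrableOn_compact_subset hKΩ hK).mul_continuousOn hφ.continuousOn hK
  exact (integrableOn_iff_integrable_of_support_subset
    fun x hx => hs (right_ne_zero_of_mul hx)).1 h2

/-! ### Weak harmonicity across `E` -/

section WeaklyHarmonic

variable {m : ℕ} {Ω E : Set (EuclideanSpace ℝ (Fin (m + 1)))}
  {u φ : EuclideanSpace ℝ (Fin (m + 1)) → ℝ}

theorem integral_mul_secondPartial (hE : μH[(m : ℝ)] E = 0)
    (hu : ∀ x ∈ Ω \ E, ContDiffAt ℝ 2 u x)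
    (hu_int : LocallyIntegrableOn u Ω) (j : Fin (m + 1))
    (hu_int₂ : LocallyIntegrableOn (secondPartial j u) Ω)
    (hφ : ContDiff ℝ 2 φ) (hφc : HasCompactSupport φ) (hφΩ : tsupport φ ⊆ Ω) :
    ∫ x, u x * secondPartial j φ x = ∫ x, secondPartial j u x * φ x := by
  have i1 : Integrable fun x => u x * secondPartial j φ x :=
    hu_int.integrable_mul_of_support_subset hφc hφΩ (continuous_secondPartial j hφ)
      (support_secondPartial_subset j φ)
  have i2 : Integrable fun x => secondPartial j u x * φ x :=
    hu_int₂.integrable_mul_of_support_subset hφc hφΩ hφ.continuous subset_closure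
  -- Taking the difference first leaves a single integrable function, whose integral over almost
  -- every line vanishes.
  rw [← sub_eq_zero, ← integral_sub i1 i2,
    ← (measurePreserving_insertCoord j).integral_comp (measurableEmbedding_insertCoord j),
    Measure.volume_eq_prod]
  refine (integral_prod_symm _ ((measurePreserving_insertCoord j).integrable_comp_of_integrable
    (i1.sub i2))).trans (integral_eq_zero_of_ae ?_)
  filter_upwards [ae_forall_insertCoord_notMem j hE] with z hz
  set a := insertCoord j (0, z)
  set e : EuclideanSpace ℝ (Fin (m + 1)) := EuclideanSpace.single j 1
  have hline : ContDiff ℝ 2 fun t : ℝ => a + t • e := by fun_prop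
  have hemb : Topology.IsClosedEmbedding fun t : ℝ => a + t • e := by
    refine Isometry.isClosedEmbedding (Isometry.of_dist_eq fun s t => ?_)
    rw [dist_add_left, dist_eq_norm, ← sub_smul, norm_smul, dist_eq_norm]
    simp [e]
  have hsub : ∀ t ∈ tsupport fun t : ℝ => φ (a + t • e), a + t • e ∈ tsupport φ := fun t ht =>
    tsupport_comp_subset_preimage φ hline.continuous ht
  have := integral_mul_deriv_deriv_sub_eq_zero (f := fun t => u (a + t • e))
    (p := fun t => φ (a + t • e)) (hφ.comp hline) (hφc.comp_isClosedEmbedding hemb) fun t ht => by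
      have hmem : a + t • e ∈ Ω \ E :=
        ⟨hφΩ (hsub t ht), by rw [← insertCoord_eq_add_smul]; exact hz t⟩
      exact (hu _ hmem).comp t hline.contDiffAt
  rw [Pi.zero_apply, ← this]
  refine integral_congr_ae (.of_forall fun t => ?_)
  simp only [Function.comp_apply, Pi.sub_apply]
  rw [insertCoord_eq_add_smul, secondPartial_add_smul, secondPartial_add_smul]

theorem integral_mul_sum_secondPartial_eq_zero (hE : μH[(m : ℝ)] E = 0)
    (hu : InnerProductSpace.HarmonicOnNhd u (Ω \ E))
    (hu_int : LocallyIntegrableOn u Ω)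
    (hu_int₂ : ∀ j, LocallyIntegrableOn (secondPartial j u) Ω)
    (hφ : ContDiff ℝ 2 φ) (hφc : HasCompactSupport φ) (hφΩ : tsupport φ ⊆ Ω) :
    ∫ x, u x * ∑ j, secondPartial j φ x = 0 := by
  simp_rw [Finset.mul_sum]
  rw [integral_finsetSum _ fun j _ => hu_int.integrable_mul_of_support_subset hφc hφΩ
    (continuous_secondPartial j hφ) (support_secondPartial_subset j φ)]
  simp_rw [fun j => integral_mul_secondPartial hE (fun x hx => (hu x hx).1) hu_int j (hu_int₂ j)
    hφ hφc hφΩ]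
  rw [← integral_finsetSum _ fun j _ => (hu_int₂ j).integrable_mul_of_support_subset hφc hφΩ
    hφ.continuous subset_closure]
  refine integral_eq_zero_of_ae ?_
  filter_upwards [measure_eq_zero_iff_ae_notMem.1 (volume_eq_zero_of_hausdorffMeasure_eq_zero hE)]
    with x hx
  by_cases hxΩ : x ∈ Ω
  · rw [← Finset.sum_mul, sum_secondPartial_eq_laplacian (hu x ⟨hxΩ, hx⟩).1,
      (hu x ⟨hxΩ, hx⟩).2.eq_of_nhds]
    simp
  · simp [image_eq_zero_of_notMem_tsupport fun h => hxΩ (hφΩ h)]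

end WeaklyHarmonic

/-! ### A radial kernel and its scale derivative -/

section RadialKernel

open Filter Topology

theorem exists_radial_profile (F : Type*) [NormedAddCommGroup F] [InnerProductSpace ℝ F]
    [Nontrivial F] [FiniteDimensional ℝ F] [MeasurableSpace F] [BorelSpace F] (μ : Measure F)
    [μ.IsAddHaarMeasure] :
    ∃ G : ℝ → ℝ, ContDiff ℝ 3 G ∧ (∀ s, 1 < s → G s = 0) ∧ (∀ s, 0 ≤ deriv G s) ∧
      ∫ x : F, deriv G (‖x‖ ^ 2) ∂μ = 1 := by
  set H : ℝ → ℝ := fun s => -Real.smoothTransition (1 - s) with hH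
  have hH3 : ContDiff ℝ 3 H :=
    (Real.smoothTransition.contDiff (n := 3).comp (contDiff_const.sub contDiff_id)).neg
  have hH0 : ∀ s, 1 < s → H s = 0 := fun s hs => by
    simp [hH, Real.smoothTransition.zero_of_nonpos (sub_nonpos.2 hs.le)]
  have hmono : Monotone H := fun s t hst =>
    neg_le_neg (Real.smoothTransition.monotone (sub_le_sub_left hst 1))
  have hd : ∀ s, 0 ≤ deriv H s := fun s => hmono.deriv_nonneg
  have hdc : Continuous (deriv H) := hH3.continuous_deriv (by norm_num)
  have hd0 : ∀ s, 1 < s → deriv H s = 0 := fun s hs => by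
    have : H =ᶠ[𝓝 s] fun _ => 0 := by
      filter_upwards [lt_mem_nhds hs] with t ht using hH0 t ht
    rw [this.deriv_eq]; simp
  have hcont : Continuous fun x : F => deriv H (‖x‖ ^ 2) := hdc.comp (by fun_prop)
  have hcs : HasCompactSupport fun x : F => deriv H (‖x‖ ^ 2) := by
    refine HasCompactSupport.intro (isCompact_closedBall (0 : F) 1) fun x hx => hd0 _ ?_
    rw [mem_closedBall_zero_iff, not_le] at hx
    nlinarith
  have hpos : 0 < ∫ x : F, deriv H (‖x‖ ^ 2) ∂μ := by
    -- `H` rises from -1 to 0 on `[0, 1]`, so its derivative equals 1 at some `s`, hence the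
    -- integrand is positive where `‖x‖ = √s`.
    obtain ⟨s, hs, hs'⟩ := exists_deriv_eq_slope H zero_lt_one hH3.continuous.continuousOn
      (hH3.differentiable (by norm_num)).differentiableOn
    obtain ⟨x, hx⟩ := exists_norm_eq F (Real.sqrt_nonneg s)
    refine hcont.integral_pos_of_hasCompactSupport_nonneg_nonzero hcs (fun x => hd _) (x := x) ?_
    rw [hx, Real.sq_sqrt hs.1.le, hs']
    simp [hH]
  set c := ∫ x : F, deriv H (‖x‖ ^ 2) ∂μ
  have hder : deriv (fun s => c⁻¹ * H s) = fun s => c⁻¹ * deriv H s := by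
    ext s
    exact deriv_const_mul _ ((hH3.differentiable (by norm_num)) s)
  refine ⟨fun s => c⁻¹ * H s, contDiff_const.mul hH3, fun s hs => by simp [hH0 s hs], fun s => ?_,
    ?_⟩
  · rw [hder]
    exact mul_nonneg (inv_nonneg.2 hpos.le) (hd s)
  · rw [hder, integral_const_mul]
    exact inv_mul_cancel₀ hpos.ne'

/-- The radial kernel `lᵈ G'(l²‖z‖²)` of width `1/l`, with `d` the dimension, built from a profile `G`. -/
noncomputable def radialKernel {F : Type*} [NormedAddCommGroup F] [NormedSpace ℝ F] (G : ℝ → ℝ)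
    (l : ℝ) (z : F) : ℝ :=
  l ^ Module.finrank ℝ F * deriv G (l ^ 2 * ‖z‖ ^ 2)

theorem deriv_eq_zero_of_forall_gt {G : ℝ → ℝ} {a : ℝ} (hG : ∀ s, a < s → G s = 0) :
    ∀ s, a < s → deriv G s = 0 := fun s hs => by
  have : G =ᶠ[𝓝 s] fun _ => 0 := by
    filter_upwards [lt_mem_nhds hs] with t ht using hG t ht
  rw [this.deriv_eq]; simp

theorem one_lt_sq_mul_sq {r l a : ℝ} (hr : 0 < r) (hl : 1 / r < l) (ha : r < a) :
    1 < l ^ 2 * a ^ 2 := by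
  have hl0 : 0 < l := (by positivity : 0 < 1 / r).trans hl
  have h1 : 1 < l * r := (div_lt_iff₀ hr).1 hl
  have h2 : 1 < l * a := h1.trans (mul_lt_mul_of_pos_left ha hl0)
  rw [← mul_pow]
  exact one_lt_pow₀ h2 two_ne_zero

theorem radialKernel_eq_zero {F : Type*} [NormedAddCommGroup F] [NormedSpace ℝ F] {G : ℝ → ℝ}
    (hG : ∀ s, 1 < s → G s = 0) {r l : ℝ} (hr : 0 < r) (hl : 1 / r < l) {z : F} (hz : r < ‖z‖) :
    radialKernel G l z = 0 := by
  rw [radialKernel, deriv_eq_zero_of_forall_gt hG _ (one_lt_sq_mul_sq hr hl hz), mul_zero]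

theorem secondPartial_radial {n : ℕ} {G : ℝ → ℝ} (hG : ContDiff ℝ 3 G) (l : ℝ)
    (x y : EuclideanSpace ℝ (Fin n)) (j : Fin n) :
    secondPartial j (fun y => G (l ^ 2 * ‖x - y‖ ^ 2)) y =
      4 * l ^ 4 * (x - y) j ^ 2 * deriv (deriv G) (l ^ 2 * ‖x - y‖ ^ 2) +
        2 * l ^ 2 * deriv G (l ^ 2 * ‖x - y‖ ^ 2) := by
  set a := (x - y) j with ha
  have hq : ∀ t : ℝ, ‖x - (y + t • EuclideanSpace.single j 1)‖ ^ 2 =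
      ‖x - y‖ ^ 2 - 2 * t * a + t ^ 2 := fun t => by
    rw [← sub_sub, norm_sub_sq_real, inner_smul_right, EuclideanSpace.inner_single_right, norm_smul]
    simp [ha]
    ring
  have h0 := secondPartial_add_smul j (fun y => G (l ^ 2 * ‖x - y‖ ^ 2)) y 0
  rw [zero_smul, add_zero] at h0
  rw [h0]
  simp_rw [hq]
  set b := ‖x - y‖ ^ 2
  have hp : ∀ t : ℝ, HasDerivAt (fun t : ℝ => l ^ 2 * (b - 2 * t * a + t ^ 2))
      (l ^ 2 * (2 * t - 2 * a)) t := fun t => by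
    have h1 := (((((hasDerivAt_id t).const_mul 2).mul_const a).const_sub b).add
      ((hasDerivAt_id t).pow 2)).const_mul (l ^ 2)
    refine h1.congr_deriv ?_
    simp only [id, mul_one]
    push_cast
    ring
  have hG1 : ContDiff ℝ 2 (deriv G) := hG.deriv' (n := 2)
  have hd1 : (deriv fun t : ℝ => G (l ^ 2 * (b - 2 * t * a + t ^ 2))) =
      fun t => deriv G (l ^ 2 * (b - 2 * t * a + t ^ 2)) * (l ^ 2 * (2 * t - 2 * a)) := by
    ext t
    exact (((hG.differentiable (by norm_num)) _).hasDerivAt.comp t (hp t)).deriv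
  rw [hd1]
  have h2 : HasDerivAt (fun t : ℝ => l ^ 2 * (2 * t - 2 * a)) (l ^ 2 * 2) 0 := by
    refine ((((hasDerivAt_id (0 : ℝ)).const_mul 2).sub_const (2 * a)).const_mul (l ^ 2)).congr_deriv
      (by simp)
  have h3 := ((((hG1.differentiable (by norm_num)) _).hasDerivAt.comp (0 : ℝ) (hp 0)).mul h2).deriv
  refine (Eq.trans ?_ h3).trans ?_
  · rfl
  · simp
    ring

theorem sum_secondPartial_radial {n : ℕ} {G : ℝ → ℝ} (hG : ContDiff ℝ 3 G) (l : ℝ)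
    (x y : EuclideanSpace ℝ (Fin n)) :
    ∑ j, secondPartial j (fun y => G (l ^ 2 * ‖x - y‖ ^ 2)) y =
      4 * l ^ 4 * ‖x - y‖ ^ 2 * deriv (deriv G) (l ^ 2 * ‖x - y‖ ^ 2) +
        n * (2 * l ^ 2 * deriv G (l ^ 2 * ‖x - y‖ ^ 2)) := by
  simp_rw [secondPartial_radial hG]
  rw [Finset.sum_add_distrib, ← Finset.sum_mul, ← Finset.mul_sum,
    EuclideanSpace.real_norm_sq_eq (x - y)]
  simp

/-- This identity makes the means of a weakly harmonic function independent of `l`. The factor is a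
quotient because `n` may be less than 3. -/
theorem hasDerivAt_radialKernel {n : ℕ} {G : ℝ → ℝ} (hG : ContDiff ℝ 3 G) {l : ℝ} (hl : l ≠ 0)
    (x y : EuclideanSpace ℝ (Fin n)) :
    HasDerivAt (fun l => radialKernel G l (x - y)) (l ^ n / (2 * l ^ 3) *
      ∑ j, secondPartial j (fun y => G (l ^ 2 * ‖x - y‖ ^ 2)) y) l := by
  rw [sum_secondPartial_radial hG]
  simp only [radialKernel, finrank_euclideanSpace_fin]
  have hG1 : ContDiff ℝ 2 (deriv G) := hG.deriv' (n := 2)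
  have h1 : HasDerivAt (fun l : ℝ => l ^ 2 * ‖x - y‖ ^ 2) (2 * l * ‖x - y‖ ^ 2) l := by
    simpa using (hasDerivAt_pow 2 l).mul_const (‖x - y‖ ^ 2)
  have h2 := (hasDerivAt_pow n l).mul
    (((hG1.differentiable (by norm_num)) _).hasDerivAt.comp l h1)
  refine h2.congr_deriv ?_
  rcases n with _ | n
  · simp
    field_simp
    ring
  · simp
    field_simp
    ring

end RadialKernel

/-! ### Weyl's lemma by radial means -/

section RadialMean

open Filter Topology

variable {n : ℕ} {Ω : Set (EuclideanSpace ℝ (Fin n))} {u : EuclideanSpace ℝ (Fin n) → ℝ}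
  {G : ℝ → ℝ}

theorem continuous_radialKernel (hG : ContDiff ℝ 3 G) (l : ℝ) (x : EuclideanSpace ℝ (Fin n)) :
    Continuous fun y => radialKernel G l (x - y) := by
  have := hG.continuous_deriv (by norm_num)
  unfold radialKernel
  fun_prop

theorem integrable_mul_radialKernel (hu : LocallyIntegrableOn u Ω) (hG : ContDiff ℝ 3 G)
    (hG0 : ∀ s, 1 < s → G s = 0) {x : EuclideanSpace ℝ (Fin n)} {r l : ℝ} (hr : 0 < r)
    (hΩ : Metric.closedBall x r ⊆ Ω) (hl : 1 / r < l) :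
    Integrable fun y => u y * radialKernel G l (x - y) := by
  refine hu.integrable_mul_of_support_subset (isCompact_closedBall x r) hΩ
    (continuous_radialKernel hG l x) fun y hy => ?_
  by_contra h
  refine hy (radialKernel_eq_zero hG0 hr hl ?_)
  rwa [Metric.mem_closedBall', dist_eq_norm, not_le] at h

theorem hasDerivAt_integral_radialKernel (hu : LocallyIntegrableOn u Ω)
    (hweak : ∀ φ : EuclideanSpace ℝ (Fin n) → ℝ, ContDiff ℝ 2 φ → HasCompactSupport φ →
      tsupport φ ⊆ Ω → ∫ y, u y * ∑ j, secondPartial j φ y = 0)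
    (hG : ContDiff ℝ 3 G) (hG0 : ∀ s, 1 < s → G s = 0) {x : EuclideanSpace ℝ (Fin n)} {r l : ℝ}
    (hr : 0 < r) (hΩ : Metric.closedBall x r ⊆ Ω) (hl : 1 / r < l) :
    HasDerivAt (fun l => ∫ y, u y * radialKernel G l (x - y)) 0 l := by
  have hr' : 0 < 1 / r := by positivity
  have hG0' := deriv_eq_zero_of_forall_gt hG0
  have hG0'' := deriv_eq_zero_of_forall_gt hG0'
  -- The `l`-derivative of the kernel, written out so that it is visibly continuous in both
  -- variables and hence bounded on a compact set.
  set D : ℝ × EuclideanSpace ℝ (Fin n) → ℝ := fun p => p.1 ^ n / (2 * p.1 ^ 3) *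
    (4 * p.1 ^ 4 * ‖x - p.2‖ ^ 2 * deriv (deriv G) (p.1 ^ 2 * ‖x - p.2‖ ^ 2) +
      n * (2 * p.1 ^ 2 * deriv G (p.1 ^ 2 * ‖x - p.2‖ ^ 2))) with hD
  have hc1 : Continuous (deriv G) := hG.continuous_deriv (by norm_num)
  have hc2 : Continuous (deriv (deriv G)) := (hG.deriv' (n := 2)).continuous_deriv (by norm_num)
  have hDc : ContinuousOn D (Set.Icc (1 / r) (l + 1) ×ˢ Metric.closedBall x r) := by
    refine ContinuousOn.mul (ContinuousOn.div (by fun_prop) (by fun_prop) fun p hp => ?_)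
      (by fun_prop)
    have : 0 < p.1 := hr'.trans_le hp.1.1
    positivity
  have hD0 : ∀ k, 1 / r < k → ∀ y ∉ Metric.closedBall x r, D (k, y) = 0 := fun k hk y hy => by
    rw [Metric.mem_closedBall', dist_eq_norm, not_le] at hy
    have := one_lt_sq_mul_sq hr hk hy
    simp [hD, hG0' _ this, hG0'' _ this]
  obtain ⟨C, hC⟩ := (isCompact_Icc.prod (isCompact_closedBall x r)).exists_bound_of_continuousOn hDc
  have hphi : ∀ k, 1 / r < k → ∫ y, u y * D (k, y) = 0 := fun k hk => by
    have hsub : (Function.support fun y => G (k ^ 2 * ‖x - y‖ ^ 2)) ⊆ Metric.closedBall x r := by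
      intro y hy
      by_contra h
      rw [Metric.mem_closedBall', dist_eq_norm, not_le] at h
      exact hy (hG0 _ (one_lt_sq_mul_sq hr hk h))
    have h1 := hweak (fun y => G (k ^ 2 * ‖x - y‖ ^ 2))
      ((hG.of_le (by norm_num)).comp
        (contDiff_const.mul ((contDiff_const.sub contDiff_id).norm_sq ℝ)))
      (HasCompactSupport.intro' (isCompact_closedBall x r) Metric.isClosed_closedBall
        fun y hy => Function.notMem_support.1 fun h => hy (hsub h))
      ((closure_minimal hsub Metric.isClosed_closedBall).trans hΩ)
    simp_rw [sum_secondPartial_radial hG] at h1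
    simp_rw [hD, mul_left_comm (u _)]
    rw [integral_const_mul, h1, mul_zero]
  have hint := hasDerivAt_integral_of_dominated_loc_of_deriv_le (μ := volume)
    (F := fun k y => u y * radialKernel G k (x - y)) (F' := fun k y => u y * D (k, y)) (x₀ := l)
    (s := Set.Ioo (1 / r) (l + 1))
    (bound := (Metric.closedBall x r).indicator fun y => ‖u y‖ * C)
    (Ioo_mem_nhds hl (lt_add_one l)) ?_ (integrable_mul_radialKernel hu hG hG0 hr hΩ hl) ?_ ?_ ?_ ?_
  · rw [hphi l hl] at hint
    exact hint.2
  · filter_upwards [lt_mem_nhds hl] with k hk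
    exact (integrable_mul_radialKernel hu hG hG0 hr hΩ hk).aestronglyMeasurable
  · refine (hu.integrable_mul_of_support_subset (isCompact_closedBall x r) hΩ ?_
      fun y hy => ?_).aestronglyMeasurable
    · simp only [hD]
      fun_prop
    · by_contra h
      exact hy (hD0 l hl y h)
  · refine .of_forall fun y k hk => ?_
    by_cases hy : y ∈ Metric.closedBall x r
    · rw [Set.indicator_of_mem hy, norm_mul]
      gcongr
      exact hC (k, y) ⟨⟨hk.1.le, hk.2.le⟩, hy⟩
    · rw [Set.indicator_of_notMem hy, hD0 k hk.1 y hy]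
      simp
  · rw [integrable_indicator_iff Metric.isClosed_closedBall.measurableSet]
    exact (hu.integrableOn_compact_subset hΩ (isCompact_closedBall x r)).norm.mul_const C
  · refine .of_forall fun y k hk => ?_
    have := (hasDerivAt_radialKernel hG (hr'.trans hk.1).ne' x y).const_mul (u y)
    rwa [sum_secondPartial_radial hG] at this

theorem tendsto_integral_radialKernel (hu : LocallyIntegrableOn u Ω)
    (hG0 : ∀ s, 1 < s → G s = 0) (hGd : ∀ s, 0 ≤ deriv G s)
    (hG1 : ∫ z : EuclideanSpace ℝ (Fin n), deriv G (‖z‖ ^ 2) = 1)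
    {x : EuclideanSpace ℝ (Fin n)} {r : ℝ}
    (hr : 0 < r) (hΩ : Metric.closedBall x r ⊆ Ω) (hux : ContinuousAt u x) :
    Tendsto (fun l => ∫ y, u y * radialKernel G l (x - y)) atTop (𝓝 (u x)) := by
  -- Cutting off makes `u` globally integrable and changes nothing where the kernel lives once `l >
  -- 1 / r`.
  set f := (Metric.closedBall x r).indicator u with hf
  have hfu : f =ᶠ[𝓝 x] u := by
    filter_upwards [Metric.closedBall_mem_nhds x hr] with y hy using Set.indicator_of_mem hy u
  have hfi : Integrable f := (integrable_indicator_iff Metric.isClosed_closedBall.measurableSet).2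
    (hu.integrableOn_compact_subset hΩ (isCompact_closedBall x r))
  have h := tendsto_integral_comp_smul_smul_of_integrable' (μ := volume)
    (φ := fun z : EuclideanSpace ℝ (Fin n) => deriv G (‖z‖ ^ 2)) (fun z => hGd _) hG1 ?_ hfi
    (hux.congr hfu.symm)
  · rw [hfu.eq_of_nhds] at h
    refine h.congr' ?_
    filter_upwards [eventually_gt_atTop (1 / r)] with l hl
    refine integral_congr_ae (.of_forall fun y => ?_)
    simp only [norm_smul, mul_pow, Real.norm_eq_abs, sq_abs, smul_eq_mul]
    by_cases hy : y ∈ Metric.closedBall x r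
    · rw [hf, Set.indicator_of_mem hy, mul_comm, radialKernel]
    · rw [hf, Set.indicator_of_notMem hy, radialKernel_eq_zero hG0 hr hl]
      · simp
      · rwa [Metric.mem_closedBall', dist_eq_norm, not_le] at hy
  · refine tendsto_const_nhds.congr' ?_
    filter_upwards [tendsto_norm_cobounded_atTop.eventually_gt_atTop 1] with z hz
    rw [deriv_eq_zero_of_forall_gt hG0 _ (one_lt_pow₀ hz two_ne_zero), mul_zero]

theorem integral_radialKernel_eq (hu : LocallyIntegrableOn u Ω)
    (hweak : ∀ φ : EuclideanSpace ℝ (Fin n) → ℝ, ContDiff ℝ 2 φ → HasCompactSupport φ →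
      tsupport φ ⊆ Ω → ∫ y, u y * ∑ j, secondPartial j φ y = 0)
    (hG : ContDiff ℝ 3 G) (hG0 : ∀ s, 1 < s → G s = 0) (hGd : ∀ s, 0 ≤ deriv G s)
    (hG1 : ∫ z : EuclideanSpace ℝ (Fin n), deriv G (‖z‖ ^ 2) = 1)
    {x : EuclideanSpace ℝ (Fin n)} {r l : ℝ}
    (hr : 0 < r) (hΩ : Metric.closedBall x r ⊆ Ω) (hl : 1 / r < l) (hux : ContinuousAt u x) :
    ∫ y, u y * radialKernel G l (x - y) = u x := by
  have hder := fun k hk => hasDerivAt_integral_radialKernel hu hweak hG hG0 hr hΩ (l := k) hk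
  refine tendsto_nhds_unique (tendsto_const_nhds.congr' ?_)
    (tendsto_integral_radialKernel hu hG0 hGd hG1 hr hΩ hux)
  filter_upwards [eventually_gt_atTop (1 / r)] with k hk
  exact isOpen_Ioi.is_const_of_deriv_eq_zero isPreconnected_Ioi
    (fun t ht => (hder t ht).differentiableAt.differentiableWithinAt)
    (fun t ht => (hder t ht).deriv) hl hk

/-- A weakly harmonic function is locally given, at its points of continuity, by one smooth
function. -/
theorem exists_contDiff_eventually_eq [NeZero n] (hΩo : IsOpen Ω) (hu : LocallyIntegrableOn u Ω)
    (hweak : ∀ φ : EuclideanSpace ℝ (Fin n) → ℝ, ContDiff ℝ 2 φ → HasCompactSupport φ →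
      tsupport φ ⊆ Ω → ∫ y, u y * ∑ j, secondPartial j φ y = 0)
    {x₀ : EuclideanSpace ℝ (Fin n)} (hx₀ : x₀ ∈ Ω) :
    ∃ w : EuclideanSpace ℝ (Fin n) → ℝ, ContDiff ℝ 2 w ∧
      ∀ᶠ x in 𝓝 x₀, ContinuousAt u x → w x = u x := by
  obtain ⟨G, hG, hG0, hGd, hG1⟩ :=
    exists_radial_profile (EuclideanSpace ℝ (Fin n)) volume
  obtain ⟨R, hR, hRΩ⟩ := Metric.nhds_basis_closedBall.mem_iff.1 (hΩo.mem_nhds hx₀)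
  -- With half the radius, balls of radius `r` about points near `x₀` stay in the `R`-ball, so one
  -- kernel and one cutoff serve them all.
  set r := R / 2 with hr_def
  have hr : 0 < r := by positivity
  set l := 1 / r + 1
  have hl : 1 / r < l := lt_add_one _
  set f := (Metric.closedBall x₀ R).indicator u with hf
  have hfi : Integrable f := (integrable_indicator_iff Metric.isClosed_closedBall.measurableSet).2
    (hu.integrableOn_compact_subset hRΩ (isCompact_closedBall x₀ R))
  have hk : ContDiff ℝ 2 fun z : EuclideanSpace ℝ (Fin n) => radialKernel G l z :=
    contDiff_const.mul ((hG.deriv' (n := 2)).comp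
      (contDiff_const.mul (contDiff_id.norm_sq ℝ)))
  have hkc : HasCompactSupport fun z : EuclideanSpace ℝ (Fin n) => radialKernel G l z :=
    HasCompactSupport.intro (isCompact_closedBall 0 r) fun z hz =>
      radialKernel_eq_zero hG0 hr hl (by rwa [mem_closedBall_zero_iff, not_le] at hz)
  refine ⟨convolution f (fun z => radialKernel G l z) (ContinuousLinearMap.lsmul ℝ ℝ) volume,
    hkc.contDiff_convolution_right (n := 2) _ hfi.locallyIntegrable hk, ?_⟩
  filter_upwards [Metric.ball_mem_nhds x₀ hr] with x hx hux
  have hxR : Metric.closedBall x r ⊆ Metric.closedBall x₀ R :=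
    Metric.closedBall_subset_closedBall' (by
      have := Metric.mem_ball.1 hx
      linarith)
  rw [← integral_radialKernel_eq hu hweak hG hG0 hGd hG1 hr (hxR.trans hRΩ) hl hux, convolution_def]
  refine integral_congr_ae (.of_forall fun y => ?_)
  simp only [ContinuousLinearMap.lsmul_apply, smul_eq_mul]
  by_cases hy : y ∈ Metric.closedBall x₀ R
  · rw [hf, Set.indicator_of_mem hy]
  · rw [hf, Set.indicator_of_notMem hy, radialKernel_eq_zero hG0 hr hl]
    · simp
    · have : y ∉ Metric.closedBall x r := fun h => hy (hxR h)
      rwa [Metric.mem_closedBall', dist_eq_norm, not_le] at this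

end RadialMean

/-! ### Gluing and uniqueness -/

open Filter Topology in
theorem corollary5 (n : ℕ) (hn : 2 ≤ n)
    (Ω E : Set (EuclideanSpace ℝ (Fin n)))
    (hΩ_open : IsOpen Ω) (hΩ_conn : IsConnected Ω)
    (hE_sub : E ⊆ Ω) (hE_closed : IsClosed ((↑) ⁻¹' E : Set Ω))
    (hE_null : μH[(n : ℝ) - 1] E = 0)
    (u : EuclideanSpace ℝ (Fin n) → ℝ)
    (hu : InnerProductSpace.HarmonicOnNhd u (Ω \ E))
    (hu_int : LocallyIntegrableOn u Ω volume)
    (hu_int₂ : ∀ j : Fin n, LocallyIntegrableOn (secondPartial j u) Ω volume) :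
    ∃ v : EuclideanSpace ℝ (Fin n) → ℝ,
      (InnerProductSpace.HarmonicOnNhd v Ω ∧ Set.EqOn v u (Ω \ E)) ∧
      ∀ w : EuclideanSpace ℝ (Fin n) → ℝ,
        InnerProductSpace.HarmonicOnNhd w Ω → Set.EqOn w u (Ω \ E) → Set.EqOn w v Ω := by
  obtain ⟨m, rfl⟩ : ∃ m, n = m + 1 := ⟨n - 1, by omega⟩
  have hE : μH[(m : ℝ)] E = 0 := by simpa using hE_null
  have hfreq : ∀ x, ∃ᶠ y in 𝓝 x, y ∉ E := fun x => mem_closure_iff_frequently.1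
    (Measure.dense_of_ae (measure_eq_zero_iff_ae_notMem.1
      (volume_eq_zero_of_hausdorffMeasure_eq_zero hE)) x)
  have huniq : ∀ {x} {f g : EuclideanSpace ℝ (Fin (m + 1)) → ℝ}, ContinuousAt f x →
      ContinuousAt g x → (∀ᶠ y in 𝓝 x, y ∉ E → f y = g y) → f x = g x := by
    intro x f g hf hg h
    by_contra hne
    have h1 := (hf.sub hg).eventually_ne (sub_ne_zero.2 hne)
    obtain ⟨y, hy, hy1, hy2⟩ := ((hfreq x).and_eventually (h1.and h)).exists
    exact hy1 (sub_eq_zero.2 (hy2 hy))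
  have hex : ∀ x ∈ Ω, ∃ w : EuclideanSpace ℝ (Fin (m + 1)) → ℝ, ContDiff ℝ 2 w ∧
      ∀ᶠ y in 𝓝 x, y ∉ E → w y = u y := fun x hx => by
    obtain ⟨w, hw, hwu⟩ := exists_contDiff_eventually_eq hΩ_open hu_int
      (fun φ => integral_mul_sum_secondPartial_eq_zero hE hu hu_int hu_int₂) hx
    refine ⟨w, hw, ?_⟩
    filter_upwards [hwu, hΩ_open.mem_nhds hx] with y hy hyΩ hyE
    exact hy (hu y ⟨hyΩ, hyE⟩).1.continuousAt
  choose! W hW hWu using hex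
  -- Local extensions agree off `E`, so by continuity also on `E`; the diagonal `W y y` is therefore
  -- locally a single `W x`.
  have hloc : ∀ x ∈ Ω, (fun y => W y y) =ᶠ[𝓝 x] W x := fun x hx => by
    filter_upwards [(hWu x hx).eventually_nhds, hΩ_open.mem_nhds hx] with y hy hyΩ
    refine huniq (hW y hyΩ).continuous.continuousAt (hW x hx).continuous.continuousAt ?_
    filter_upwards [hy, hWu y hyΩ] with z hz hz' hzE
    rw [hz hzE, hz' hzE]
  have hopen : IsOpen (Ω \ E) := by
    have := hΩ_open.isOpenMap_subtype_val _ hE_closed.isOpen_compl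
    convert this using 1
    ext x
    simp
  have heq : Set.EqOn (fun y => W y y) u (Ω \ E) := fun x hx =>
    (hWu x hx.1).self_of_nhds hx.2
  refine ⟨fun y => W y y, ⟨fun x hx => ?_, heq⟩, fun w hw hwu x hx => ?_⟩
  · rw [InnerProductSpace.harmonicAt_congr_nhds (hloc x hx)]
    refine ⟨(hW x hx).contDiffAt, ?_⟩
    -- The Laplacian of `W x` vanishes near `x` off `E`; continuity carries this across `E`.
    have hcont : Continuous (Laplacian.laplacian (W x)) := by
      simp_rw [InnerProductSpace.laplacian_eq_iteratedFDeriv_stdOrthonormalBasis]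
      have := (hW x hx).continuous_iteratedFDeriv (m := 2) le_rfl
      fun_prop
    filter_upwards [(hWu x hx).eventually_nhds, hΩ_open.mem_nhds hx] with y hy hyΩ
    refine huniq (g := 0) hcont.continuousAt continuousAt_const ?_
    filter_upwards [hy.eventually_nhds, hΩ_open.mem_nhds hyΩ] with z hz hzΩ hzE
    have hWz : W x =ᶠ[𝓝 z] u := by
      filter_upwards [hz, hopen.mem_nhds ⟨hzΩ, hzE⟩] with a ha haΩ using ha haΩ.2
    rw [(InnerProductSpace.laplacian_congr_nhds hWz).eq_of_nhds, (hu z ⟨hzΩ, hzE⟩).2.eq_of_nhds]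
  · refine huniq (g := fun y => W y y) (hw x hx).1.continuousAt
      ((hW x hx).continuous.continuousAt.congr (hloc x hx).symm) ?_
    filter_upwards [hΩ_open.mem_nhds hx] with y hy hyE
    exact (hwu ⟨hy, hyE⟩).trans (heq ⟨hy, hyE⟩).symm
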